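/- Let $\Omega\subset\mathbb{R}^3$ be open, bounded and convex with Lebesgue measure $\mathcal{L}^3(\Omega)=1$, let $N\geq 2$, and let $\mathbf{m}=(m_1,\dots,m_N)$ satisfy $m_i>0$ and $\sum_{i=1}^N m_i=1$. Put $$D=\{\mathbf{z}=(z_1,\dots,z_N)\in(\mathbb{R}^3)^N : z_i\neq z_j \text{ whenever } i\neq j\}.$$ For $\mathbf{z}\in D$ and $\mathbf{w}\in\mathbb{R}^N$ define the Laguerre cells $$C_i(\mathbf{z},\mathbf{w})=\{x\in\Omega : |x-z_i|^2-w_i\leq|x-z_j|^2-w_j\ \text{ for all } j\in\{1,\dots,N\}\},$$ let $\mathbf{w}_*(\mathbf{z})$ be the unique maximiser with $N$-th component $0$ of the Kantorovich functional $$g(\mathbf{w})=\sum_{i=1}^N\int_{C_i(\mathbf{z},\mathbf{w})}|x-z_i|^2\,\mathrm{d}x+\sum_{i=1}^N\big(m_i-\mathcal{L}^3(C_i(\mathbf{z},\mathbf{w}))\big)w_i$$ over $\mathbf{w}\in\mathbb{R}^N$, and let $\mathbf{x}(\mathbf{z})=(x_1(\mathbf{z}),\dots,x_N(\mathbf{z}))$,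 where $x_i(\mathbf{z})$ is the centroid of $C_i(\mathbf{z},\mathbf{w}_*(\mathbf{z}))$. Let $J_N=\mathrm{diag}(J,\dots,J)\in\mathbb{R}^{3N\times 3N}$ with $$J=\begin{pmatrix}0&-1&0\\1&0&0\\0&0&0\end{pmatrix}.$$ If $\overline{\mathbf{z}}=(\overline z_1,\dots,\overline z_N)\in\mathbb{R}^{3N}$ satisfies $$\min_{i\neq j}|(\overline z_i-\overline z_j)\cdot e_3|\geq r$$ for some $r>0$, where $e_3$ is the third standard basis vector, then for every $T\in(0,\infty)$ there exists a unique $C^1$ map $\mathbf{z}:[0,T]\to D$ such that $$\dot{\mathbf{z}}(t)=J_N\big(\mathbf{z}(t)-\mathbf{x}(\mathbf{z}(t))\big)\ \text{ for all } t\in[0,T],\qquad \mathbf{z}(0)=\overline{\mathbf{z}},$$ with one-sided derivatives at the end points. -/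

import Mathlib

open MeasureTheory Set

noncomputable section

namespace SemiGeostrophic

/-- Three-dimensional Euclidean space, with the Euclidean norm and Lebesgue measure `volume`. -/
abbrev E3 : Type := EuclideanSpace ℝ (Fin 3)

/-- The third canonical basis vector of `ℝ³`. -/
def e3 : E3 := EuclideanSpace.single 2 1

/-- The rotation matrix `J`. -/
def J : Matrix (Fin 3) (Fin 3) ℝ :=
  !![0, -1, 0;
     1,  0, 0;
     0,  0, 0]

/-- The action of the block diagonal matrix `J_N = diag(J, …, J)` on
`ℝ^{3N} = ℝ³ × ⋯ × ℝ³`: each block of three coordinates is multiplied by `J`. -/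
def JN {N : ℕ} (v : Fin N → E3) : Fin N → E3 :=
  fun i => Matrix.toEuclideanLin J (v i)

/-- The set `D` of seed vectors: the seeds are pairwise distinct. -/
def seedSet (N : ℕ) : Set (Fin N → E3) :=
  {z | ∀ i j, i ≠ j → z i ≠ z j}

/-- The Laguerre cell `C_i(z, w)` of the domain `Ω`. -/
def laguerreCell {N : ℕ} (Ω : Set E3) (z : Fin N → E3) (w : Fin N → ℝ) (i : Fin N) : Set E3 :=
  {x | x ∈ Ω ∧ ∀ j, ‖x - z i‖ ^ 2 - w i ≤ ‖x - z j‖ ^ 2 - w j}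

/-- The Kantorovich functional
`g(w) = ∑ i, ∫_{C_i(z,w)} |x - z_i|² dx + ∑ i, (m_i - |C_i(z,w)|) w_i`. -/
def kantorovich {N : ℕ} (Ω : Set E3) (m : Fin N → ℝ) (z : Fin N → E3) (w : Fin N → ℝ) : ℝ :=
  (∑ i, ∫ x in laguerreCell Ω z w i, ‖x - z i‖ ^ 2) +
    ∑ i, (m i - volume.real (laguerreCell Ω z w i)) * w i

/-- An optimal weight vector is a maximiser of the Kantorovich functional over `ℝ^N`. -/
def IsOptimalWeight {N : ℕ} (Ω : Set E3) (m : Fin N → ℝ) (z : Fin N → E3)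
    (w : Fin N → ℝ) : Prop :=
  ∀ w' : Fin N → ℝ, kantorovich Ω m z w' ≤ kantorovich Ω m z w

/-- The optimal weight map `w_*`: the optimal weight vector whose last component is zero.
(For an open bounded convex `Ω` of volume one, a mass vector `m` and pairwise distinct seeds there
is exactly one such vector; the value at other arguments is irrelevant.) -/
def optimalWeight {N : ℕ} (Ω : Set E3) (m : Fin N → ℝ) (z : Fin N → E3) : Fin N → ℝ :=
  Classical.epsilon fun w => IsOptimalWeight Ω m z w ∧ ∀ i : Fin N, (i : ℕ) + 1 = N → w i = 0

/-- The centroid map: the centroid of each Laguerre cell `C_i(z, w)`. -/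
def centroidMap {N : ℕ} (Ω : Set E3) (z : Fin N → E3) (w : Fin N → ℝ) : Fin N → E3 :=
  fun i => (volume.real (laguerreCell Ω z w i))⁻¹ • ∫ x in laguerreCell Ω z w i, x

/-- The optimal centroid map `x(z)`: the centroids of the cells of the optimal Laguerre
tessellation of `Ω` generated by `z`. -/
def optimalCentroid {N : ℕ} (Ω : Set E3) (m : Fin N → ℝ) (z : Fin N → E3) : Fin N → E3 :=
  centroidMap Ω z (optimalWeight Ω m z)

/-- The vector field `W(z) = J_N (z - x(z))`. -/
def vectorField {N : ℕ} (Ω : Set E3) (m : Fin N → ℝ) (z : Fin N → E3) : Fin N → E3 :=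
  JN (z - optimalCentroid Ω m z)

/-- `z` is a `C¹`-solution on `[0, T]` of the initial value problem `ż = W(z)`, `z(0) = zbar`.
It takes its values in the set `D` on which `W` is defined. Only the values of `z` on `[0, T]`
matter; derivatives at the end points are one-sided. -/
structure IsC1Solution {N : ℕ} (Ω : Set E3) (m : Fin N → ℝ) (zbar : Fin N → E3) (T : ℝ)
    (z : ℝ → Fin N → E3) : Prop where
  contDiffOn : ContDiffOn ℝ 1 z (Icc 0 T)
  mem_seedSet : ∀ t ∈ Icc 0 T, z t ∈ seedSet N
  ode : ∀ t ∈ Icc 0 T, HasDerivWithinAt z (vectorField Ω m (z t)) (Icc 0 T) t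
  init : z 0 = zbar

end SemiGeostrophic

end

open MeasureTheory Set

noncomputable section

namespace SemiGeostrophic

/-! Since `J` annihilates the third coordinate, seed heights are conserved, so the seeds stay
separated by `r` and collisions are impossible. It remains to see that the field is Lipschitz on
configurations with the heights of `zbar`. Height separation makes every set of near-ties between
two seeds a slab of volume O(ε) (`volume_slab_le`, `volume_tieSet_le`). Hence perturbing all costs
by ε changes the minimal total cost by its first-order term up to O(ε²)
(`sum_setIntegral_sub_le_integral_minCost`). This gives the optimal cells the masses `m i`. It also
makes the maximal Kantorovich value minus `∑ i, m i * ‖z i‖ ^ 2` concave, with supergradient `-2 m_i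
x_i(z)`, and bounded below by its linearisation up to a quadratic error (`maxKantorovich_le`,
`le_maxKantorovich`). Co-coercivity turns this into a Lipschitz bound for the horizontal centroid
coordinates (`abs_optimalCentroid_sub_le`), the only ones `J` sees. Freezing the heights by
`withHeights` gives a globally Lipschitz field, whose global solution solves the original problem
and is unique. -/

/-! ### Volume of slabs -/

/-- The matrix of `x ↦ (x₀, x₁, ⟨x, a⟩)`. -/
def slabMatrix (a : E3) : Matrix (Fin 3) (Fin 3) ℝ :=
  !![1, 0, 0;
     0, 1, 0;
     a 0, a 1, a 2]

lemma det_slabMatrix (a : E3) : (slabMatrix a).det = a 2 := by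
  simp [slabMatrix, Matrix.det_fin_three]

lemma inner_eq (x a : E3) : inner ℝ x a = x 0 * a 0 + x 1 * a 1 + x 2 * a 2 := by
  simp [PiLp.inner_apply, Fin.sum_univ_three]; ring

lemma abs_apply_le_norm (x : E3) (i : Fin 3) : |x i| ≤ ‖x‖ := by
  simpa using PiLp.norm_apply_le x i

/-- The map `slabMatrix a`, of determinant `a 2`, sends the slab into a box with sides `2R`, `2R`,
`2ε`. -/
lemma volume_slab_le {Ω : Set E3} {R : ℝ} (hR : ∀ x ∈ Ω, ‖x‖ ≤ R) (hR0 : 0 ≤ R)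
    {a : E3} {r : ℝ} (hr : 0 < r) (ha : r ≤ |a 2|) (c : ℝ) {ε : ℝ} (hε : 0 ≤ ε) :
    volume {x ∈ Ω | |inner ℝ x a - c| ≤ ε} ≤ ENNReal.ofReal (8 * R ^ 2 / r * ε) := by
  have ha2 : a 2 ≠ 0 := by
    intro h; rw [h, abs_zero] at ha; linarith
  set box : Set (Fin 3 → ℝ) := Icc ![-R, -R, c - ε] ![R, R, c + ε] with hbox
  set L := Matrix.toLin' (slabMatrix a) with hL
  have hdet : LinearMap.det L = a 2 := by
    rw [hL, LinearMap.det_toLin', det_slabMatrix]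
  have hsub : {x ∈ Ω | |inner ℝ x a - c| ≤ ε} ⊆
      (MeasurableEquiv.toLp 2 (Fin 3 → ℝ)).symm ⁻¹' (L ⁻¹' box) := by
    rintro x ⟨hx, hxs⟩
    have hxR := hR x hx
    have h0 := abs_le.1 ((abs_apply_le_norm x 0).trans hxR)
    have h1 := abs_le.1 ((abs_apply_le_norm x 1).trans hxR)
    have h2 := abs_le.1 hxs
    rw [inner_eq] at h2
    simp only [mem_preimage, hbox, mem_Icc, Pi.le_def, hL, Matrix.toLin'_apply, slabMatrix,
      Fin.forall_fin_succ, Matrix.mulVec, dotProduct, Fin.sum_univ_three]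
    simp
    refine ⟨⟨h0.1, h1.1, ?_⟩, h0.2, h1.2, ?_⟩ <;> linarith
  have hvol : volume box = ENNReal.ofReal (8 * R ^ 2 * ε) := by
    rw [hbox, Real.volume_Icc_pi, Fin.prod_univ_three]
    simp only [Matrix.cons_val]
    rw [← ENNReal.ofReal_mul (by linarith), ← ENNReal.ofReal_mul (by nlinarith)]
    congr 1; ring
  calc _ ≤ _ := measure_mono hsub
    _ = volume (L ⁻¹' box) :=
        (EuclideanSpace.volume_preserving_symm_measurableEquiv_toLp (Fin 3)).measure_preimage_equiv _
    _ = ENNReal.ofReal |(a 2)⁻¹| * ENNReal.ofReal (8 * R ^ 2 * ε) := by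
        rw [Measure.addHaar_preimage_linearMap _ (by rwa [hdet]), hdet, hvol]
    _ ≤ _ := by
        rw [← ENNReal.ofReal_mul (abs_nonneg _)]
        apply ENNReal.ofReal_le_ofReal
        rw [abs_inv, div_mul_eq_mul_div, div_eq_inv_mul]
        have : |a 2|⁻¹ ≤ r⁻¹ := inv_anti₀ hr ha
        gcongr

/-! ### Global existence for Lipschitz fields -/

section RadialRetraction

open scoped NNReal

variable {E : Type*} [NormedAddCommGroup E] [NormedSpace ℝ E]

/-- The radial retraction onto the closed ball of radius `B` about the origin. -/
def radialRetraction (B : ℝ) (x : E) : E := (B / max B ‖x‖) • x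

lemma radialRetraction_of_norm_le {B : ℝ} (hB : 0 < B) {x : E} (hx : ‖x‖ ≤ B) :
    radialRetraction B x = x := by
  rw [radialRetraction, max_eq_left hx, div_self hB.ne', one_smul]

lemma norm_radialRetraction_le {B : ℝ} (hB : 0 < B) (x : E) :
    ‖radialRetraction B x‖ ≤ B := by
  have hm : 0 < max B ‖x‖ := lt_max_of_lt_left hB
  rw [radialRetraction, norm_smul, Real.norm_of_nonneg (by positivity), div_mul_eq_mul_div,
    div_le_iff₀ hm]
  gcongr
  exact le_max_right _ _

lemma norm_radialRetraction_le_norm {B : ℝ} (hB : 0 < B) (x : E) :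
    ‖radialRetraction B x‖ ≤ ‖x‖ := by
  have hm : 0 < max B ‖x‖ := lt_max_of_lt_left hB
  rw [radialRetraction, norm_smul, Real.norm_of_nonneg (by positivity)]
  exact mul_le_of_le_one_left (norm_nonneg _) ((div_le_one hm).2 (le_max_left _ _))

lemma lipschitzWith_radialRetraction {B : ℝ} (hB : 0 < B) :
    LipschitzWith 2 (radialRetraction B : E → E) := by
  refine LipschitzWith.of_dist_le_mul fun x y => ?_
  rw [dist_eq_norm, dist_eq_norm]
  have hx : 0 < max B ‖x‖ := lt_max_of_lt_left hB
  have hy : 0 < max B ‖y‖ := lt_max_of_lt_left hB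
  have hsplit : radialRetraction B x - radialRetraction B y =
      (B / max B ‖x‖) • (x - y) + (B / max B ‖x‖ - B / max B ‖y‖) • y := by
    simp only [radialRetraction, smul_sub, sub_smul]; abel
  have h1 : ‖(B / max B ‖x‖) • (x - y)‖ ≤ ‖x - y‖ := by
    rw [norm_smul, Real.norm_of_nonneg (by positivity)]
    exact mul_le_of_le_one_left (norm_nonneg _) ((div_le_one hx).2 (le_max_left _ _))
  -- Over the common denominator, `B` and `‖y‖` are each absorbed by one of the two maxima.
  have h2 : ‖(B / max B ‖x‖ - B / max B ‖y‖) • y‖ ≤ ‖x - y‖ := by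
    have hd : |max B ‖y‖ - max B ‖x‖| ≤ ‖x - y‖ := by
      rw [max_comm B, max_comm B]
      refine (abs_max_sub_max_le_abs _ _ _).trans ?_
      rw [norm_sub_rev]; exact abs_norm_sub_norm_le _ _
    rw [norm_smul, Real.norm_eq_abs, div_sub_div _ _ hx.ne' hy.ne', ← mul_comm B, ← mul_sub,
      abs_div, abs_mul, abs_of_pos hB, abs_of_pos (mul_pos hx hy), div_mul_eq_mul_div,
      div_le_iff₀ (mul_pos hx hy)]
    calc B * |max B ‖y‖ - max B ‖x‖| * ‖y‖ ≤ max B ‖x‖ * ‖x - y‖ * max B ‖y‖ := by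
          gcongr
          exacts [le_max_left _ _, le_max_right _ _]
      _ = _ := by ring
  rw [hsplit]
  refine (norm_add_le _ _).trans ?_
  push_cast
  linarith

/-- A globally Lipschitz autonomous ordinary differential equation has global solutions. -/
theorem exists_hasDerivWithinAt_of_lipschitzWith [CompleteSpace E] {f : E → E} {K : ℝ≥0}
    (hf : LipschitzWith K f) (x₀ : E) {T : ℝ} (hT : 0 ≤ T) :
    ∃ z : ℝ → E, z 0 = x₀ ∧ ∀ t ∈ Icc 0 T, HasDerivWithinAt z (f (z t)) (Icc 0 T) t := by
  -- `B` exceeds the a priori Grönwall bound. The truncated field is bounded, so Picard–Lindelöf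
  -- covers all of `[0, T]` at once, and its solution never leaves the ball where truncation does
  -- nothing.
  set B : ℝ := max 1 (gronwallBound ‖x₀‖ K ‖f 0‖ T) with hBdef
  have hB : 0 < B := lt_of_lt_of_le one_pos (le_max_left _ _)
  set g : E → E := fun x => f (radialRetraction B x) with hg
  have hgl : LipschitzWith (K * 2) g := hf.comp (lipschitzWith_radialRetraction hB)
  have hfb (x : E) : ‖f x‖ ≤ K * ‖x‖ + ‖f 0‖ := by
    have h1 := hf.dist_le_mul x 0
    rw [dist_eq_norm, dist_zero_right] at h1
    have h2 := norm_le_norm_add_norm_sub' (f x) (f 0)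
    linarith
  set L : ℝ≥0 := K * B.toNNReal + ‖f 0‖₊ with hLdef
  have hL (x : E) : ‖g x‖ ≤ L := by
    refine (hfb _).trans ?_
    rw [hLdef]
    push_cast
    rw [Real.coe_toNNReal _ hB.le]
    gcongr
    exact norm_radialRetraction_le hB x
  have hpl : IsPicardLindelof (fun _ => g) (tmin := 0) (tmax := T) ⟨0, le_rfl, hT⟩ x₀
      (L * T.toNNReal) 0 L (K * 2) := by
    refine ⟨fun _ _ => hgl.lipschitzOnWith, fun _ _ => continuousOn_const, fun _ _ x _ => hL x, ?_⟩
    simp [Real.coe_toNNReal _ hT, hT]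
  obtain ⟨z, hz0, hz⟩ := hpl.exists_eq_forall_mem_Icc_hasDerivWithinAt₀
  refine ⟨z, hz0, fun t ht => ?_⟩
  have hbound : ‖z t‖ ≤ B := by
    have h1 := norm_le_gronwallBound_of_norm_deriv_right_le (f := z) (f' := fun s => g (z s))
      (δ := ‖x₀‖) (K := K) (ε := ‖f 0‖) (a := 0) (b := T)
      (fun s hs => (hz s hs).continuousWithinAt)
      (fun s hs => (hz s (Ico_subset_Icc_self hs)).mono_of_mem_nhdsWithin
        (Icc_mem_nhdsGE_of_mem hs)) (le_of_eq (congrArg norm hz0))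
      (fun s _ => (hfb _).trans (by gcongr; exact norm_radialRetraction_le_norm hB _)) t ht
    refine h1.trans (le_max_of_le_right ?_)
    exact gronwallBound_mono (norm_nonneg _) (norm_nonneg _) K.2 (by linarith [ht.2])
  have := hz t ht
  simp only [hg, radialRetraction_of_norm_le hB hbound] at this
  exact this

end RadialRetraction

/-! ### Laguerre cells and stability of the minimal cost -/

section Cells
variable {N : ℕ} {Ω : Set E3} {R r : ℝ} {m : Fin N → ℝ} {z z' : Fin N → E3} {w w' : Fin N → ℝ}

/-- The heights of the seeds are at mutual distance at least `r`. -/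
def HeightSeparated (r : ℝ) (z : Fin N → E3) : Prop :=
  ∀ i j, i ≠ j → r ≤ |z i 2 - z j 2|

/-- The cost of sending `x` to the `i`-th seed, reduced by the weight of that seed. -/
def reducedCost (z : Fin N → E3) (w : Fin N → ℝ) (x : E3) (i : Fin N) : ℝ :=
  ‖x - z i‖ ^ 2 - w i

/-- The least reduced cost. -/
def minCost [NeZero N] (z : Fin N → E3) (w : Fin N → ℝ) (x : E3) : ℝ :=
  Finset.univ.inf' Finset.univ_nonempty (reducedCost z w x)

/-- The points of `Ω` at which two of the reduced costs differ by at most `2 ε`. -/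
def tieSet (Ω : Set E3) (z : Fin N → E3) (w : Fin N → ℝ) (ε : ℝ) : Set E3 :=
  {x | x ∈ Ω ∧ ∃ i j, i ≠ j ∧ |reducedCost z w x i - reducedCost z w x j| ≤ 2 * ε}

/-- The constant in the linear bound for the volume of `tieSet`. -/
def tieConst (N : ℕ) (R r : ℝ) : ℝ := (N : ℝ) ^ 2 * (8 * R ^ 2 / r)

lemma tieConst_nonneg (hr : 0 < r) : 0 ≤ tieConst N R r := by
  unfold tieConst; positivity

lemma continuous_reducedCost (z : Fin N → E3) (w : Fin N → ℝ) (i : Fin N) :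
    Continuous fun x => reducedCost z w x i := by
  unfold reducedCost; fun_prop

lemma continuous_minCost [NeZero N] (z : Fin N → E3) (w : Fin N → ℝ) :
    Continuous (minCost z w) :=
  Continuous.finset_inf'_apply _ fun i _ => continuous_reducedCost z w i

lemma minCost_le [NeZero N] (z : Fin N → E3) (w : Fin N → ℝ) (x : E3) (i : Fin N) :
    minCost z w x ≤ reducedCost z w x i :=
  Finset.inf'_le _ (Finset.mem_univ i)

lemma le_minCost [NeZero N] {x : E3} {c : ℝ} (h : ∀ i, c ≤ reducedCost z w x i) :
    c ≤ minCost z w x :=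
  Finset.le_inf' _ _ fun i _ => h i

lemma minCost_eq_of_mem [NeZero N] {x : E3} {i : Fin N} (hx : x ∈ laguerreCell Ω z w i) :
    minCost z w x = reducedCost z w x i :=
  le_antisymm (minCost_le z w x i) (le_minCost hx.2)

/-- The term `‖x‖ ^ 2` cancels, so the change is affine in `x`: its integral over a cell needs only
volume and centroid. -/
lemma reducedCost_change (z z' : Fin N → E3) (w w' : Fin N → ℝ) (x : E3) (i : Fin N) :
    reducedCost z' w' x i = reducedCost z w x i - 2 * inner ℝ x (z' i - z i) +
      (‖z' i‖ ^ 2 - ‖z i‖ ^ 2 + w i - w' i) := by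
  simp only [reducedCost, norm_sub_sq_real, inner_sub_right]; ring

lemma laguerreCell_subset (i : Fin N) : laguerreCell Ω z w i ⊆ Ω := fun _ hx => hx.1

lemma measurableSet_laguerreCell (hΩ : IsOpen Ω) (i : Fin N) :
    MeasurableSet (laguerreCell Ω z w i) := by
  have : laguerreCell Ω z w i =
      Ω ∩ ⋂ j, {x | reducedCost z w x i ≤ reducedCost z w x j} := by
    ext x; simp [laguerreCell, reducedCost]
  rw [this]
  exact hΩ.measurableSet.inter (MeasurableSet.iInter fun j =>
    (isClosed_le (continuous_reducedCost z w i) (continuous_reducedCost z w j)).measurableSet)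

lemma measurableSet_tieSet (hΩ : IsOpen Ω) (ε : ℝ) : MeasurableSet (tieSet Ω z w ε) := by
  have : tieSet Ω z w ε = Ω ∩ ⋃ i, ⋃ j, ⋃ (_ : i ≠ j),
      {x | |reducedCost z w x i - reducedCost z w x j| ≤ 2 * ε} := by
    ext x; simp [tieSet]
  rw [this]
  refine hΩ.measurableSet.inter (.iUnion fun i => .iUnion fun j => .iUnion fun _ => ?_)
  exact (isClosed_le ((continuous_reducedCost z w i).sub
    (continuous_reducedCost z w j)).abs continuous_const).measurableSet

lemma iUnion_laguerreCell [NeZero N] : ⋃ i, laguerreCell Ω z w i = Ω := by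
  refine subset_antisymm (iUnion_subset fun i => laguerreCell_subset i) fun x hx => ?_
  obtain ⟨i, hi⟩ := Finite.exists_min (reducedCost z w x)
  exact mem_iUnion.2 ⟨i, hx, hi⟩

lemma volume_tieSet_le (hR : ∀ x ∈ Ω, ‖x‖ ≤ R) (hR0 : 0 ≤ R) (hr : 0 < r)
    (hz : HeightSeparated r z) (w : Fin N → ℝ) {ε : ℝ} (hε : 0 ≤ ε) :
    volume (tieSet Ω z w ε) ≤ ENNReal.ofReal (tieConst N R r * ε) := by
  classical
  set slab : Fin N × Fin N → Set E3 := fun p =>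
    if p.1 = p.2 then ∅ else {x ∈ Ω | |inner ℝ x (z p.1 - z p.2) -
      (‖z p.1‖ ^ 2 - w p.1 - (‖z p.2‖ ^ 2 - w p.2)) / 2| ≤ ε} with hslab
  have hsub : tieSet Ω z w ε ⊆ ⋃ p ∈ (Finset.univ : Finset (Fin N × Fin N)), slab p := by
    rintro x ⟨hx, i, j, hij, h⟩
    refine mem_iUnion₂.2 ⟨(i, j), Finset.mem_univ _, ?_⟩
    simp only [hslab, if_neg hij]
    refine ⟨hx, ?_⟩
    have e : reducedCost z w x i - reducedCost z w x j = -2 * (inner ℝ x (z i - z j) -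
        (‖z i‖ ^ 2 - w i - (‖z j‖ ^ 2 - w j)) / 2) := by
      simp only [reducedCost, norm_sub_sq_real, inner_sub_right]; ring
    rw [e, abs_mul, abs_neg, abs_two] at h
    linarith
  calc volume (tieSet Ω z w ε) ≤ ∑ p, volume (slab p) :=
        (measure_mono hsub).trans (measure_biUnion_finset_le _ _)
    _ ≤ ∑ _p : Fin N × Fin N, ENNReal.ofReal (8 * R ^ 2 / r * ε) := by
        refine Finset.sum_le_sum fun p _ => ?_
        by_cases hp : p.1 = p.2
        · simp [hslab, hp]
        · simp only [hslab, if_neg hp]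
          exact volume_slab_le hR hR0 hr (by simpa using hz _ _ hp) _ hε
    _ = _ := by
        rw [Finset.sum_const, Finset.card_univ, Fintype.card_prod, Fintype.card_fin,
          nsmul_eq_mul, tieConst, ← ENNReal.ofReal_natCast, ← ENNReal.ofReal_mul (by positivity)]
        congr 1
        push_cast
        ring

/-- Two cells meet only at exact ties, the case `ε = 0` of the volume bound. -/
lemma aedisjoint_laguerreCell (hR : ∀ x ∈ Ω, ‖x‖ ≤ R) (hR0 : 0 ≤ R) (hr : 0 < r)
    (hz : HeightSeparated r z) (w : Fin N → ℝ) :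
    Pairwise (Function.onFun (AEDisjoint volume) (laguerreCell Ω z w)) := by
  intro i j hij
  refine measure_mono_null (t := tieSet Ω z w 0) ?_ ?_
  · rintro x ⟨hi, hj⟩
    refine ⟨hi.1, i, j, hij, ?_⟩
    have : reducedCost z w x i = reducedCost z w x j := le_antisymm (hi.2 j) (hj.2 i)
    simp [this]
  · simpa using volume_tieSet_le hR hR0 hr hz w le_rfl

lemma integrableOn_of_continuous {F : Type*} [NormedAddCommGroup F]
    (hR : ∀ x ∈ Ω, ‖x‖ ≤ R) {f : E3 → F} (hf : Continuous f) : IntegrableOn f Ω :=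
  (hf.continuousOn.integrableOn_compact (isCompact_closedBall 0 R)).mono_set
    fun x hx => by simpa using hR x hx

lemma sum_setIntegral_laguerreCell [NeZero N] (hΩ : IsOpen Ω) (hR : ∀ x ∈ Ω, ‖x‖ ≤ R)
    (hR0 : 0 ≤ R) (hr : 0 < r) (hz : HeightSeparated r z) (w : Fin N → ℝ) {f : E3 → ℝ}
    (hf : IntegrableOn f Ω) : ∑ i, ∫ x in laguerreCell Ω z w i, f x = ∫ x in Ω, f x := by
  conv_rhs => rw [← iUnion_laguerreCell (Ω := Ω) (z := z) (w := w)]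
  rw [integral_iUnion_ae (fun i => (measurableSet_laguerreCell hΩ i).nullMeasurableSet)
    (aedisjoint_laguerreCell hR hR0 hr hz w) (by rwa [iUnion_laguerreCell]), tsum_fintype]

/-- The Kantorovich functional in dual form. -/
lemma kantorovich_eq [NeZero N] (hΩ : IsOpen Ω) (hR : ∀ x ∈ Ω, ‖x‖ ≤ R) (hR0 : 0 ≤ R)
    (hvol : volume Ω = 1)
    (hr : 0 < r) (hz : HeightSeparated r z) (m w : Fin N → ℝ) :
    kantorovich Ω m z w = (∫ x in Ω, minCost z w x) + ∑ i, m i * w i := by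
  have key (i : Fin N) : ∫ x in laguerreCell Ω z w i, minCost z w x =
      (∫ x in laguerreCell Ω z w i, ‖x - z i‖ ^ 2) -
        volume.real (laguerreCell Ω z w i) * w i := by
    have hfin : volume (laguerreCell Ω z w i) ≠ ⊤ :=
      ne_top_of_le_ne_top (by simp [hvol]) (measure_mono (laguerreCell_subset i))
    rw [setIntegral_congr_fun (measurableSet_laguerreCell hΩ i)
      (fun x hx => minCost_eq_of_mem hx)]
    simp only [reducedCost]
    rw [integral_sub, setIntegral_const, smul_eq_mul]
    · exact (integrableOn_of_continuous hR (by fun_prop)).mono_set (laguerreCell_subset i)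
    · exact integrableOn_const hfin
  rw [← sum_setIntegral_laguerreCell hΩ hR hR0 hr hz w
    (integrableOn_of_continuous hR (continuous_minCost z w)), kantorovich]
  simp only [key, sub_mul, Finset.sum_sub_distrib]
  ring

lemma integral_minCost_le [NeZero N] (hΩ : IsOpen Ω) (hR : ∀ x ∈ Ω, ‖x‖ ≤ R) (hR0 : 0 ≤ R)
    (hr : 0 < r) (hz : HeightSeparated r z) (w : Fin N → ℝ) (z' : Fin N → E3)
    (w' : Fin N → ℝ) :
    ∫ x in Ω, minCost z' w' x ≤ ∑ i, ∫ x in laguerreCell Ω z w i, reducedCost z' w' x i := by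
  rw [← sum_setIntegral_laguerreCell hΩ hR hR0 hr hz w
    (integrableOn_of_continuous hR (continuous_minCost z' w'))]
  refine Finset.sum_le_sum fun i _ => setIntegral_mono ?_ ?_ fun x => minCost_le z' w' x i
  · exact (integrableOn_of_continuous hR (continuous_minCost z' w')).mono_set
      (laguerreCell_subset i)
  · exact (integrableOn_of_continuous hR (continuous_reducedCost z' w' i)).mono_set
      (laguerreCell_subset i)

/-- Off the tie set the winner leads by more than `2 * ε`, so it survives the perturbation; on it
the loss is at most `2 * ε`. -/
lemma reducedCost_sub_indicator_le_minCost [NeZero N] {ε : ℝ} {x : E3} {i : Fin N}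
    (hx : x ∈ laguerreCell Ω z w i)
    (h : ∀ j, |reducedCost z' w' x j - reducedCost z w x j| ≤ ε) :
    reducedCost z' w' x i - (tieSet Ω z w ε).indicator (fun _ => 2 * ε) x ≤
      minCost z' w' x := by
  have hε : 0 ≤ ε := (abs_nonneg _).trans (h i)
  refine le_minCost fun j => ?_
  have hi := abs_le.1 (h i)
  have hj := abs_le.1 (h j)
  have hij : reducedCost z w x i ≤ reducedCost z w x j := hx.2 j
  by_cases ht : x ∈ tieSet Ω z w ε
  · rw [indicator_of_mem ht]; linarith
  · rw [indicator_of_notMem ht]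
    by_cases e : i = j
    · subst e; linarith
    · have : 2 * ε < |reducedCost z w x i - reducedCost z w x j| := by
        by_contra! hc
        exact ht ⟨hx.1, i, j, e, hc⟩
      rw [abs_of_nonpos (by linarith)] at this
      linarith

/-- A uniformly small perturbation of the costs changes the optimal assignment only on a set of
small measure, so that the old assignment is optimal up to a quadratic error. -/
lemma sum_setIntegral_sub_le_integral_minCost [NeZero N] (hΩ : IsOpen Ω)
    (hR : ∀ x ∈ Ω, ‖x‖ ≤ R) (hR0 : 0 ≤ R) (hvol : volume Ω = 1) (hr : 0 < r)
    (hz : HeightSeparated r z) {ε : ℝ} (hε : 0 ≤ ε)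
    (h : ∀ x ∈ Ω, ∀ j, |reducedCost z' w' x j - reducedCost z w x j| ≤ ε) :
    (∑ i, ∫ x in laguerreCell Ω z w i, reducedCost z' w' x i) -
      2 * tieConst N R r * ε ^ 2 ≤ ∫ x in Ω, minCost z' w' x := by
  have hfinΩ : volume Ω ≠ ⊤ := by simp [hvol]
  have htm : MeasurableSet (tieSet Ω z w ε) := measurableSet_tieSet hΩ ε
  set I : E3 → ℝ := (tieSet Ω z w ε).indicator fun _ => 2 * ε with hI
  have hIint : IntegrableOn I Ω := (integrableOn_const hfinΩ).indicator htm
  have hIval : ∫ x in Ω, I x ≤ 2 * tieConst N R r * ε ^ 2 := by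
    rw [hI, setIntegral_indicator htm, setIntegral_const, smul_eq_mul]
    have h1 : volume.real (Ω ∩ tieSet Ω z w ε) ≤ tieConst N R r * ε := by
      refine ENNReal.toReal_le_of_le_ofReal (mul_nonneg (tieConst_nonneg hr) hε) ?_
      exact (measure_mono inter_subset_right).trans (volume_tieSet_le hR hR0 hr hz w hε)
    nlinarith
  have hmain : (∑ i, ∫ x in laguerreCell Ω z w i, reducedCost z' w' x i) - ∫ x in Ω, I x ≤
      ∫ x in Ω, minCost z' w' x := by
    rw [← sum_setIntegral_laguerreCell hΩ hR hR0 hr hz w hIint,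
      ← sum_setIntegral_laguerreCell hΩ hR hR0 hr hz w
        (integrableOn_of_continuous hR (continuous_minCost z' w')), ← Finset.sum_sub_distrib]
    refine Finset.sum_le_sum fun i _ => ?_
    have hc := (integrableOn_of_continuous hR (continuous_reducedCost z' w' i)).mono_set
      (laguerreCell_subset (z := z) (w := w) i)
    have hIi := hIint.mono_set (laguerreCell_subset (z := z) (w := w) i)
    rw [← integral_sub hc hIi]
    refine setIntegral_mono_on (hc.sub hIi) ((integrableOn_of_continuous hR
      (continuous_minCost z' w')).mono_set (laguerreCell_subset i))
      (measurableSet_laguerreCell hΩ i) fun x hx => ?_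
    exact reducedCost_sub_indicator_le_minCost hx (h x hx.1)
  linarith

end Cells

/-! ### Optimal weights: existence and mass constraint -/

section Optimal
variable {N : ℕ} [NeZero N] {Ω : Set E3} {R r : ℝ} {m : Fin N → ℝ} {z z' : Fin N → E3}
  {w w' : Fin N → ℝ}

lemma minCost_le_add_norm (z : Fin N → E3) (w w' : Fin N → ℝ) (x : E3) :
    minCost z w x ≤ minCost z w' x + ‖w - w'‖ := by
  rw [← sub_le_iff_le_add]
  refine le_minCost fun i => ?_
  have h1 := minCost_le z w x i
  have h2 : |w i - w' i| ≤ ‖w - w'‖ := norm_le_pi_norm (w - w') i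
  have h3 := abs_le.1 h2
  simp only [reducedCost] at *
  linarith

lemma minCost_sub_const (z : Fin N → E3) (w : Fin N → ℝ) (c : ℝ) (x : E3) :
    minCost z (fun i => w i - c) x = minCost z w x + c := by
  apply le_antisymm
  · rw [← sub_le_iff_le_add]
    refine le_minCost fun i => ?_
    have := minCost_le z (fun i => w i - c) x i
    simp only [reducedCost] at *
    linarith
  · refine le_minCost fun i => ?_
    have := minCost_le z w x i
    simp only [reducedCost] at *
    linarith

lemma continuous_integral_minCost (hR : ∀ x ∈ Ω, ‖x‖ ≤ R) (hvol : volume Ω = 1)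
    (z : Fin N → E3) : Continuous fun w => ∫ x in Ω, minCost z w x := by
  refine (LipschitzWith.of_le_add_mul 1 fun w w' => ?_).continuous
  have hfinΩ : volume Ω ≠ ⊤ := by simp [hvol]
  have hint := integrableOn_of_continuous hR (continuous_minCost z w')
  have hc : IntegrableOn (fun _ : E3 => ‖w - w'‖) Ω := integrableOn_const hfinΩ
  calc ∫ x in Ω, minCost z w x ≤ ∫ x in Ω, (minCost z w' x + ‖w - w'‖) :=
        setIntegral_mono (integrableOn_of_continuous hR (continuous_minCost z w))
          (hint.add hc) fun x => minCost_le_add_norm z w w' x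
    _ = _ := by
        rw [integral_add hint hc, setIntegral_const]
        simp [measureReal_def, hvol, dist_eq_norm]

lemma kantorovich_sub_const (hΩ : IsOpen Ω) (hR : ∀ x ∈ Ω, ‖x‖ ≤ R) (hR0 : 0 ≤ R)
    (hvol : volume Ω = 1) (hr : 0 < r) (hz : HeightSeparated r z) (hm : ∑ i, m i = 1)
    (w : Fin N → ℝ) (c : ℝ) :
    kantorovich Ω m z (fun i => w i - c) = kantorovich Ω m z w := by
  have hfinΩ : volume Ω ≠ ⊤ := by simp [hvol]
  rw [kantorovich_eq hΩ hR hR0 hvol hr hz, kantorovich_eq hΩ hR hR0 hvol hr hz]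
  simp only [minCost_sub_const]
  rw [integral_add (integrableOn_of_continuous hR (continuous_minCost z w))
    (integrableOn_const hfinΩ), setIntegral_const]
  simp only [mul_sub, Finset.sum_sub_distrib, ← Finset.sum_mul, hm]
  simp [measureReal_def, hvol]

/-- Coercivity of the Kantorovich functional on normalised weights. -/
lemma norm_le_of_kantorovich_nonneg (hΩ : IsOpen Ω) (hR : ∀ x ∈ Ω, ‖x‖ ≤ R) (hR0 : 0 ≤ R)
    (hvol : volume Ω = 1) (hr : 0 < r) (hz : HeightSeparated r z) (hm0 : ∀ i, 0 < m i)
    (hm : ∑ i, m i = 1) {l : Fin N} (hl : w l = 0) (hw : 0 ≤ kantorovich Ω m z w) :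
    ‖w‖ ≤ (R + ‖z‖) ^ 2 * ∑ i, (m i)⁻¹ := by
  have hfinΩ : volume Ω ≠ ⊤ := by simp [hvol]
  obtain ⟨k, hk⟩ := Finite.exists_max w
  have hA : ∫ x in Ω, minCost z w x ≤ (R + ‖z‖) ^ 2 - w k := by
    calc ∫ x in Ω, minCost z w x ≤ ∫ _x in Ω, ((R + ‖z‖) ^ 2 - w k) := by
          refine setIntegral_mono_on (integrableOn_of_continuous hR (continuous_minCost z w))
            (integrableOn_const hfinΩ) hΩ.measurableSet fun x hx => ?_
          refine (minCost_le z w x k).trans ?_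
          have : ‖x - z k‖ ≤ R + ‖z‖ :=
            (norm_sub_le _ _).trans (add_le_add (hR x hx) (norm_le_pi_norm z k))
          unfold reducedCost
          gcongr
      _ = _ := by rw [setIntegral_const]; simp [measureReal_def, hvol]
  -- Testing with the heaviest seed `k` bounds the `m`-average of the nonnegative gaps `w k - w i`,
  -- hence each gap; `w l = 0` then turns oscillation into norm.
  have hosc (j : Fin N) : w k - w j ≤ (R + ‖z‖) ^ 2 * ∑ i, (m i)⁻¹ := by
    have h1 : m j * (w k - w j) ≤ ∑ i, m i * (w k - w i) :=
      Finset.single_le_sum (f := fun i => m i * (w k - w i))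
        (fun i _ => mul_nonneg (hm0 i).le (sub_nonneg.2 (hk i))) (Finset.mem_univ j)
    have h2 : ∑ i, m i * (w k - w i) = w k - ∑ i, m i * w i := by
      simp only [mul_sub, Finset.sum_sub_distrib, ← Finset.sum_mul, hm, one_mul]
    rw [kantorovich_eq hΩ hR hR0 hvol hr hz] at hw
    have h3 : m j * (w k - w j) ≤ (R + ‖z‖) ^ 2 := by linarith
    have h4 : (m j)⁻¹ ≤ ∑ i, (m i)⁻¹ :=
      Finset.single_le_sum (f := fun i => (m i)⁻¹) (fun i _ => (inv_pos.2 (hm0 i)).le)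
        (Finset.mem_univ j)
    calc w k - w j = m j * (w k - w j) * (m j)⁻¹ := by field_simp [(hm0 j).ne']
      _ ≤ _ := mul_le_mul h3 h4 (inv_pos.2 (hm0 j)).le (sq_nonneg _)
  have hl' := hosc l
  have hkl := hk l
  refine (pi_norm_le_iff_of_nonneg (by linarith)).2 fun j => abs_le.2 ⟨?_, ?_⟩
  · have := hosc j
    linarith
  · have := hk j
    linarith

lemma exists_isOptimalWeight (hΩ : IsOpen Ω) (hR : ∀ x ∈ Ω, ‖x‖ ≤ R) (hR0 : 0 ≤ R)
    (hvol : volume Ω = 1) (hr : 0 < r) (hz : HeightSeparated r z) (hm0 : ∀ i, 0 < m i)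
    (hm : ∑ i, m i = 1) :
    ∃ w, IsOptimalWeight Ω m z w ∧ ∀ i : Fin N, (i : ℕ) + 1 = N → w i = 0 := by
  have hN : 0 < N := Nat.pos_of_ne_zero (NeZero.ne N)
  set l : Fin N := ⟨N - 1, by omega⟩ with hl
  set S : Set (Fin N → ℝ) :=
    Metric.closedBall 0 ((R + ‖z‖) ^ 2 * ∑ i, (m i)⁻¹) ∩ {w | w l = 0} with hS
  have hpos : 0 ≤ (R + ‖z‖) ^ 2 * ∑ i, (m i)⁻¹ :=
    mul_nonneg (sq_nonneg _) (Finset.sum_nonneg fun i _ => (inv_pos.2 (hm0 i)).le)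
  have hScomp : IsCompact S := (isCompact_closedBall _ _).inter_right
    (isClosed_eq (continuous_apply l) continuous_const)
  have h0S : (0 : Fin N → ℝ) ∈ S := ⟨Metric.mem_closedBall_self hpos, rfl⟩
  have hcont : Continuous (kantorovich Ω m z) := by
    have : kantorovich Ω m z = fun w => (∫ x in Ω, minCost z w x) + ∑ i, m i * w i :=
      funext fun w => kantorovich_eq hΩ hR hR0 hvol hr hz m w
    rw [this]
    exact (continuous_integral_minCost hR hvol z).add (by fun_prop)
  obtain ⟨w, hwS, hw⟩ := hScomp.exists_isMaxOn ⟨0, h0S⟩ hcont.continuousOn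
  have h0 : 0 ≤ kantorovich Ω m z 0 := by
    rw [kantorovich_eq hΩ hR hR0 hvol hr hz]
    simp only [Pi.zero_apply, mul_zero, Finset.sum_const_zero, add_zero]
    exact integral_nonneg fun x => le_minCost fun i => by simp [reducedCost]
  refine ⟨w, fun w' => ?_, fun i hi => ?_⟩
  -- After normalisation a competitor either lies in `S` by coercivity or has a negative value and
  -- loses to the zero weight.
  · rw [← kantorovich_sub_const hΩ hR hR0 hvol hr hz hm w' (w' l)]
    by_cases h : 0 ≤ kantorovich Ω m z (fun i => w' i - w' l)
    · refine hw ⟨?_, sub_self _⟩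
      rw [mem_closedBall_zero_iff]
      exact norm_le_of_kantorovich_nonneg hΩ hR hR0 hvol hr hz hm0 hm (l := l) (sub_self _) h
    · exact (not_le.1 h).le.trans (h0.trans (hw h0S))
  · have : i = l := Fin.ext (by simp only [hl]; omega)
    rw [this]
    exact hwS.2

lemma isOptimalWeight_optimalWeight (hΩ : IsOpen Ω) (hR : ∀ x ∈ Ω, ‖x‖ ≤ R) (hR0 : 0 ≤ R)
    (hvol : volume Ω = 1) (hr : 0 < r) (hz : HeightSeparated r z) (hm0 : ∀ i, 0 < m i)
    (hm : ∑ i, m i = 1) : IsOptimalWeight Ω m z (optimalWeight Ω m z) :=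
  (Classical.epsilon_spec (exists_isOptimalWeight hΩ hR hR0 hvol hr hz hm0 hm)).1

/-- The cells of an optimal tessellation have the prescribed volumes. -/
lemma IsOptimalWeight.volume_laguerreCell (hw : IsOptimalWeight Ω m z w) (hΩ : IsOpen Ω)
    (hR : ∀ x ∈ Ω, ‖x‖ ≤ R) (hR0 : 0 ≤ R) (hvol : volume Ω = 1) (hr : 0 < r)
    (hz : HeightSeparated r z) (hm : ∑ i, m i = 1) (i : Fin N) :
    volume.real (laguerreCell Ω z w i) = m i := by
  have hfinΩ : volume Ω ≠ ⊤ := by simp [hvol]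
  have hle (i : Fin N) : volume.real (laguerreCell Ω z w i) ≤ m i := by
    refine le_of_forall_pos_le_add fun δ hδ => ?_
    set K := 2 * tieConst N R r with hK
    have hK0 : 0 ≤ K := mul_nonneg zero_le_two (tieConst_nonneg hr)
    -- Lowering the `i`-th weight by `s` and using optimality gives excess volume at most `K * s`;
    -- `K + 1` avoids dividing by zero.
    set s : ℝ := δ / (K + 1) with hs
    have hs0 : 0 < s := by positivity
    set w' : Fin N → ℝ := w - Pi.single i s with hw'
    have hred (x : E3) (j : Fin N) :
        reducedCost z w' x j = reducedCost z w x j + (Pi.single i s : Fin N → ℝ) j := by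
      simp [reducedCost, hw']; ring
    have hpert := sum_setIntegral_sub_le_integral_minCost (w := w) (w' := w') (z' := z)
      hΩ hR hR0 hvol hr hz hs0.le (fun x _ j => by
        rw [hred, add_sub_cancel_left]
        by_cases h : j = i
        · subst h; simp [abs_of_pos hs0]
        · simp [h, hs0.le])
    have hcell : ∑ j, ∫ x in laguerreCell Ω z w j, reducedCost z w' x j =
        (∫ x in Ω, minCost z w x) + volume.real (laguerreCell Ω z w i) * s := by
      rw [← sum_setIntegral_laguerreCell hΩ hR hR0 hr hz w
        (integrableOn_of_continuous hR (continuous_minCost z w))]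
      have (j : Fin N) : ∫ x in laguerreCell Ω z w j, reducedCost z w' x j =
          (∫ x in laguerreCell Ω z w j, minCost z w x) +
            volume.real (laguerreCell Ω z w j) * (Pi.single i s : Fin N → ℝ) j := by
        have hfin : volume (laguerreCell Ω z w j) ≠ ⊤ :=
          ne_top_of_le_ne_top hfinΩ (measure_mono (laguerreCell_subset j))
        rw [setIntegral_congr_fun (g := fun x => minCost z w x + (Pi.single i s : Fin N → ℝ) j)
          (measurableSet_laguerreCell hΩ j)
          (fun x hx => by simp only [hred, minCost_eq_of_mem hx]), integral_add
          ((integrableOn_of_continuous hR (continuous_minCost z w)).mono_set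
            (laguerreCell_subset j)) (integrableOn_const hfin), setIntegral_const, smul_eq_mul]
      simp only [this, Finset.sum_add_distrib]
      simp [Pi.single_apply]
    have hopt := hw w'
    rw [kantorovich_eq hΩ hR hR0 hvol hr hz, kantorovich_eq hΩ hR hR0 hvol hr hz] at hopt
    have hlin : ∑ j, m j * w' j = (∑ j, m j * w j) - m i * s := by
      simp [hw', mul_sub, Pi.single_apply]
    rw [hcell] at hpert
    rw [hlin] at hopt
    have h1 : (volume.real (laguerreCell Ω z w i) - m i) * s ≤ K * s * s := by
      rw [hK]; nlinarith
    have h2 := le_of_mul_le_mul_right h1 hs0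
    have h3 : K * s ≤ δ := by
      rw [hs, mul_div_assoc', div_le_iff₀ (by positivity)]
      nlinarith
    linarith
  -- Both sides are one, so the one-sided bounds must be equalities.
  have hsum : ∑ i, volume.real (laguerreCell Ω z w i) = ∑ i, m i := by
    have := sum_setIntegral_laguerreCell hΩ hR hR0 hr hz w (f := fun _ => (1 : ℝ))
      (integrableOn_const hfinΩ)
    simp only [setIntegral_const, smul_eq_mul, mul_one] at this
    rw [this, hm, measureReal_def, hvol, ENNReal.toReal_one]
  exact (Finset.sum_eq_sum_iff_of_le fun i _ => hle i).1 hsum i (Finset.mem_univ i)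

end Optimal

/-! ### Lipschitz dependence of the centroids -/

section Centroid
variable {N : ℕ} [NeZero N] {Ω : Set E3} {R r : ℝ} {m : Fin N → ℝ} {z z' : Fin N → E3}

/-- The maximal value of the Kantorovich functional. -/
def maxKantorovich (Ω : Set E3) (m : Fin N → ℝ) (z : Fin N → E3) : ℝ :=
  kantorovich Ω m z (optimalWeight Ω m z)

/-- The increment of the transport cost if the seeds move from `z` to `z'` and the assignment of
the points of `Ω` to the seeds is not changed. -/
def frozenIncrement (Ω : Set E3) (m : Fin N → ℝ) (z z' : Fin N → E3) : ℝ :=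
  ∑ i, m i * (-2 * inner ℝ (optimalCentroid Ω m z i) (z' i - z i) + (‖z' i‖ ^ 2 - ‖z i‖ ^ 2))

/-- The weights `w'` cancel because the cells have volumes `m i`; the estimates below may therefore
choose them freely. -/
lemma sum_setIntegral_reducedCost (hΩ : IsOpen Ω) (hR : ∀ x ∈ Ω, ‖x‖ ≤ R) (hR0 : 0 ≤ R)
    (hvol : volume Ω = 1) (hr : 0 < r) (hm0 : ∀ i, 0 < m i) (hm : ∑ i, m i = 1)
    (hz : HeightSeparated r z) (z' : Fin N → E3) (w' : Fin N → ℝ) :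
    (∑ i, ∫ x in laguerreCell Ω z (optimalWeight Ω m z) i, reducedCost z' w' x i) +
      ∑ i, m i * w' i = maxKantorovich Ω m z + frozenIncrement Ω m z z' := by
  have hfinΩ : volume Ω ≠ ⊤ := by simp [hvol]
  set w := optimalWeight Ω m z with hw
  have hopt : IsOptimalWeight Ω m z w :=
    isOptimalWeight_optimalWeight hΩ hR hR0 hvol hr hz hm0 hm
  have hcell := hopt.volume_laguerreCell hΩ hR hR0 hvol hr hz hm
  have key (i : Fin N) : ∫ x in laguerreCell Ω z w i, reducedCost z' w' x i =
      (∫ x in laguerreCell Ω z w i, minCost z w x) -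
        2 * (m i * inner ℝ (optimalCentroid Ω m z i) (z' i - z i)) +
        m i * (‖z' i‖ ^ 2 - ‖z i‖ ^ 2 + w i - w' i) := by
    have hfin : volume (laguerreCell Ω z w i) ≠ ⊤ :=
      ne_top_of_le_ne_top hfinΩ (measure_mono (laguerreCell_subset i))
    have hid : IntegrableOn (fun x : E3 => x) (laguerreCell Ω z w i) :=
      (integrableOn_of_continuous hR continuous_id).mono_set (laguerreCell_subset i)
    have hin : IntegrableOn (fun x : E3 => 2 * inner ℝ x (z' i - z i)) (laguerreCell Ω z w i) :=
      (integrableOn_of_continuous hR (by fun_prop)).mono_set (laguerreCell_subset i)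
    have hmin : IntegrableOn (minCost z w) (laguerreCell Ω z w i) :=
      (integrableOn_of_continuous hR (continuous_minCost z w)).mono_set (laguerreCell_subset i)
    have hcent : ∫ x in laguerreCell Ω z w i, inner ℝ x (z' i - z i) =
        m i * inner ℝ (optimalCentroid Ω m z i) (z' i - z i) := by
      have h1 : ∫ x in laguerreCell Ω z w i, x = m i • optimalCentroid Ω m z i := by
        rw [optimalCentroid, centroidMap, ← hw, hcell, smul_smul, mul_inv_cancel₀ (hm0 i).ne',
          one_smul]
      simp_rw [real_inner_comm (z' i - z i)]
      rw [integral_inner hid, h1, inner_smul_right]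
    rw [setIntegral_congr_fun (g := fun x => minCost z w x - 2 * inner ℝ x (z' i - z i) +
      (‖z' i‖ ^ 2 - ‖z i‖ ^ 2 + w i - w' i)) (measurableSet_laguerreCell hΩ i)
      (fun x hx => by simp only [reducedCost_change z z' w w', minCost_eq_of_mem hx]),
      integral_add (f := fun x => minCost z w x - 2 * inner ℝ x (z' i - z i)) (hmin.sub hin)
        (integrableOn_const hfin), integral_sub hmin hin,
      integral_const_mul, setIntegral_const, hcent, hcell, smul_eq_mul]
  rw [maxKantorovich, kantorovich_eq hΩ hR hR0 hvol hr hz,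
    ← sum_setIntegral_laguerreCell hΩ hR hR0 hr hz w
      (integrableOn_of_continuous hR (continuous_minCost _ _)), frozenIncrement, ← hw]
  simp only [key, ← Finset.sum_add_distrib]
  refine Finset.sum_congr rfl fun i _ => ?_
  ring

lemma maxKantorovich_le (hΩ : IsOpen Ω) (hR : ∀ x ∈ Ω, ‖x‖ ≤ R) (hR0 : 0 ≤ R)
    (hvol : volume Ω = 1) (hr : 0 < r) (hm0 : ∀ i, 0 < m i) (hm : ∑ i, m i = 1)
    (hz : HeightSeparated r z) (hz' : HeightSeparated r z') :
    maxKantorovich Ω m z' ≤ maxKantorovich Ω m z + frozenIncrement Ω m z z' := by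
  rw [← sum_setIntegral_reducedCost hΩ hR hR0 hvol hr hm0 hm hz z' (optimalWeight Ω m z'),
    maxKantorovich, kantorovich_eq hΩ hR hR0 hvol hr hz']
  gcongr
  exact integral_minCost_le hΩ hR hR0 hr hz _ _ _

lemma le_maxKantorovich (hΩ : IsOpen Ω) (hR : ∀ x ∈ Ω, ‖x‖ ≤ R) (hR0 : 0 ≤ R)
    (hvol : volume Ω = 1) (hr : 0 < r) (hm0 : ∀ i, 0 < m i) (hm : ∑ i, m i = 1)
    (hz : HeightSeparated r z) (hz' : HeightSeparated r z') :
    maxKantorovich Ω m z + frozenIncrement Ω m z z' -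
      2 * tieConst N R r * (2 * R * ‖z' - z‖) ^ 2 ≤ maxKantorovich Ω m z' := by
  set w := optimalWeight Ω m z with hw
  -- These weights cancel the constant part of the cost change, leaving only an inner product of
  -- size at most `2 * R * ‖z' - z‖`.
  set w' : Fin N → ℝ := fun i => ‖z' i‖ ^ 2 - ‖z i‖ ^ 2 + w i with hw'
  rw [← sum_setIntegral_reducedCost hΩ hR hR0 hvol hr hm0 hm hz z' w', ← hw]
  have h1 := sum_setIntegral_sub_le_integral_minCost (w := w) (w' := w') (z' := z')
    (ε := 2 * R * ‖z' - z‖) hΩ hR hR0 hvol hr hz (by positivity) (fun x hx j => by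
      have e : reducedCost z' w' x j - reducedCost z w x j = -2 * inner ℝ x (z' j - z j) := by
        rw [reducedCost_change z z' w w']; simp only [hw']; ring
      rw [e, abs_mul, abs_neg, abs_two, mul_assoc]
      have h2 : ‖z' j - z j‖ ≤ ‖z' - z‖ := norm_le_pi_norm (z' - z) j
      have h3 := (abs_real_inner_le_norm x (z' j - z j)).trans
        (mul_le_mul (hR x hx) h2 (norm_nonneg _) hR0)
      linarith)
  have h2 := isOptimalWeight_optimalWeight hΩ hR hR0 hvol hr hz' hm0 hm w'
  rw [kantorovich_eq hΩ hR hR0 hvol hr hz'] at h2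
  change _ ≤ maxKantorovich Ω m z' at h2
  linarith

/-- The horizontal coordinates of the optimal centroids depend Lipschitz continuously on the
seeds, by co-coercivity of the gradient of a convex and semiconcave function. -/
lemma abs_optimalCentroid_sub_le (hΩ : IsOpen Ω) (hR : ∀ x ∈ Ω, ‖x‖ ≤ R) (hR0 : 0 ≤ R)
    (hvol : volume Ω = 1) (hr : 0 < r) (hm0 : ∀ i, 0 < m i) (hm : ∑ i, m i = 1)
    (hz : HeightSeparated r z) (hz' : HeightSeparated r z') (i : Fin N) {k : Fin 3}
    (hk : k ≠ 2) :
    |optimalCentroid Ω m z i k - optimalCentroid Ω m z' i k| ≤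
      8 * tieConst N R r * R ^ 2 / m i * ‖z - z'‖ := by
  rcases eq_or_ne z z' with rfl | hne
  · simp
  set D := 8 * tieConst N R r * R ^ 2 with hD
  set q := optimalCentroid Ω m z i k - optimalCentroid Ω m z' i k with hq
  have key (s : ℝ) : 2 * m i * (s * q) ≤ D * s ^ 2 + D * ‖z - z'‖ ^ 2 := by
    -- A horizontal displacement keeps the heights separated, so `z' + h` is an admissible third
    -- point.
    set h : Fin N → E3 := Pi.single i (EuclideanSpace.single k s) with hh
    have hu : HeightSeparated r (z' + h) := by
      have h2 (j : Fin N) : h j 2 = 0 := by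
        by_cases e : j = i
        · subst e; simp [hh, hk.symm]
        · simp [hh, e]
      intro a b hab
      simpa [h2] using hz' a b hab
    have hnorm : ‖z' + h - z'‖ = |s| := by
      rw [add_sub_cancel_left, hh, Pi.norm_single]; simp
    have h1 := maxKantorovich_le hΩ hR hR0 hvol hr hm0 hm hz hu
    have h2 := le_maxKantorovich hΩ hR hR0 hvol hr hm0 hm hz' hu
    have h3 := le_maxKantorovich hΩ hR hR0 hvol hr hm0 hm hz hz'
    rw [hnorm, mul_pow _ |s|, sq_abs] at h2
    rw [norm_sub_rev, mul_pow _ ‖z - z'‖] at h3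
    -- Around the triangle `z`, `z'`, `z' + h` the quadratic terms telescope, leaving the centroid
    -- difference tested against `h`.
    have hsum : frozenIncrement Ω m z z' + frozenIncrement Ω m z' (z' + h) -
        frozenIncrement Ω m z (z' + h) = 2 * m i * (s * q) := by
      simp only [frozenIncrement, ← Finset.sum_add_distrib, ← Finset.sum_sub_distrib]
      rw [Finset.sum_eq_single i]
      · have e : inner ℝ (optimalCentroid Ω m z i) (h i) -
            inner ℝ (optimalCentroid Ω m z' i) (h i) = s * q := by
          simp only [hh, Pi.single_eq_same, EuclideanSpace.inner_single_right, hq]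
          simp [mul_sub]
        simp only [Pi.add_apply, add_sub_cancel_left, inner_sub_right, inner_add_right]
        rw [← e]; ring
      · intro j _ hj
        have : h j = 0 := by simp [hh, hj]
        simp only [Pi.add_apply, this, add_zero, sub_self, inner_zero_right]
        ring
      · simp
    rw [← hsum, hD]
    linarith
  have hd : 0 < ‖z - z'‖ := norm_pos_iff.2 (sub_ne_zero.2 hne)
  have hm2 := hm0 i
  -- The choice `s = ±‖z - z'‖` balances the two error terms and covers both signs of `q`.
  have h1 := key ‖z - z'‖
  have h2 := key (-‖z - z'‖)
  have h3 : m i * |q| * ‖z - z'‖ ≤ D * ‖z - z'‖ * ‖z - z'‖ := by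
    rcases abs_cases q with ⟨e, _⟩ | ⟨e, _⟩ <;> rw [e] <;> nlinarith
  have h4 := le_of_mul_le_mul_right h3 hd
  rw [div_mul_eq_mul_div, le_div_iff₀ hm2]
  linarith

end Centroid

/-! ### The field with frozen heights -/

section Flow
variable {N : ℕ} {Ω : Set E3} {R r : ℝ} {m : Fin N → ℝ} {zbar : Fin N → E3}

/-- Replace the heights of the seeds `z` by those of `zbar`. -/
def withHeights (zbar z : Fin N → E3) : Fin N → E3 :=
  fun i => !₂[z i 0, z i 1, zbar i 2]

lemma withHeights_eq_self {z : Fin N → E3} (h : ∀ i, z i 2 = zbar i 2) :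
    withHeights zbar z = z := by
  funext i
  ext k
  fin_cases k <;> simp [withHeights, h]

lemma norm_withHeights_sub_le (z z' : Fin N → E3) :
    ‖withHeights zbar z - withHeights zbar z'‖ ≤ ‖z - z'‖ := by
  refine (pi_norm_le_iff_of_nonneg (norm_nonneg _)).2 fun i => ?_
  refine le_trans ?_ (norm_le_pi_norm (z - z') i)
  rw [EuclideanSpace.norm_eq, EuclideanSpace.norm_eq]
  apply Real.sqrt_le_sqrt
  simp only [Fin.sum_univ_three, withHeights, Pi.sub_apply, PiLp.sub_apply]
  simp
  positivity

lemma heightSeparated_withHeights (h : HeightSeparated r zbar) (z : Fin N → E3) :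
    HeightSeparated r (withHeights zbar z) := by
  intro i j hij
  simpa [withHeights] using h i j hij

lemma JN_apply (v : Fin N → E3) (i : Fin N) : JN v i = !₂[-(v i 1), v i 0, 0] := by
  ext k
  fin_cases k <;> simp [JN, J, Matrix.toLpLin_apply, dotProduct,
    Fin.sum_univ_three]

lemma norm_JN_apply_sub_le (v v' : Fin N → E3) (i : Fin N) :
    ‖JN v i - JN v' i‖ ≤ |v i 0 - v' i 0| + |v i 1 - v' i 1| := by
  rw [EuclideanSpace.norm_eq]
  apply Real.sqrt_le_iff.2 ⟨by positivity, ?_⟩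
  simp only [JN_apply, Fin.sum_univ_three, PiLp.sub_apply, Real.norm_eq_abs, sq_abs]
  simp
  nlinarith [abs_nonneg (v i 0 - v' i 0), abs_nonneg (v i 1 - v' i 1), sq_abs (v i 0 - v' i 0),
    sq_abs (v i 1 - v' i 1), mul_nonneg (abs_nonneg (v i 0 - v' i 0)) (abs_nonneg (v i 1 - v' i 1))]

lemma vectorField_height (z : Fin N → E3) (i : Fin N) : vectorField Ω m z i 2 = 0 := by
  simp [vectorField, JN_apply]

open scoped NNReal in
lemma exists_lipschitzWith_vectorField [NeZero N] (hΩ : IsOpen Ω) (hR : ∀ x ∈ Ω, ‖x‖ ≤ R)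
    (hR0 : 0 ≤ R) (hvol : volume Ω = 1) (hr : 0 < r) (hm0 : ∀ i, 0 < m i)
    (hm : ∑ i, m i = 1) (hz : HeightSeparated r zbar) :
    ∃ K : ℝ≥0, LipschitzWith K fun z => vectorField Ω m (withHeights zbar z) := by
  set D := 8 * tieConst N R r * R ^ 2 with hD
  have hD0 : 0 ≤ D := by have := tieConst_nonneg (N := N) (R := R) hr; positivity
  have hsum : 0 ≤ ∑ i, (m i)⁻¹ := Finset.sum_nonneg fun i _ => (inv_pos.2 (hm0 i)).le
  -- The sum dominates every `(m i)⁻¹`, making the bound uniform in `i`; the factor 2 counts the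
  -- horizontal coordinates.
  set K : ℝ := 2 * (1 + D * ∑ i, (m i)⁻¹) with hK
  have hK0 : 0 ≤ K := by positivity
  refine ⟨K.toNNReal, LipschitzWith.of_dist_le_mul fun z z' => ?_⟩
  rw [Real.coe_toNNReal _ hK0, dist_eq_norm, dist_eq_norm]
  refine (pi_norm_le_iff_of_nonneg (by positivity)).2 fun i => ?_
  refine (norm_JN_apply_sub_le _ _ i).trans ?_
  have hcoord (k : Fin 3) (hk : k ≠ 2) :
      |(withHeights zbar z - optimalCentroid Ω m (withHeights zbar z)) i k -
        (withHeights zbar z' - optimalCentroid Ω m (withHeights zbar z')) i k| ≤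
      (1 + D * ∑ i, (m i)⁻¹) * ‖z - z'‖ := by
    have hle := norm_withHeights_sub_le (zbar := zbar) z z'
    have h1 : |withHeights zbar z i k - withHeights zbar z' i k| ≤ ‖z - z'‖ :=
      ((abs_apply_le_norm (withHeights zbar z i - withHeights zbar z' i) k).trans
        (norm_le_pi_norm (withHeights zbar z - withHeights zbar z') i)).trans hle
    have h2 := abs_optimalCentroid_sub_le hΩ hR hR0 hvol hr hm0 hm
      (heightSeparated_withHeights hz z) (heightSeparated_withHeights hz z') i hk
    have h3 : (m i)⁻¹ ≤ ∑ i, (m i)⁻¹ :=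
      Finset.single_le_sum (f := fun i => (m i)⁻¹) (fun i _ => (inv_pos.2 (hm0 i)).le)
        (Finset.mem_univ i)
    have h4 : D / m i * ‖withHeights zbar z - withHeights zbar z'‖ ≤
        D * (∑ i, (m i)⁻¹) * ‖z - z'‖ := by
      rw [div_eq_mul_inv]; gcongr
    simp only [Pi.sub_apply, PiLp.sub_apply]
    rw [sub_sub_sub_comm]
    refine (abs_sub _ _).trans ?_
    linarith
  have h0 := hcoord 0 (by decide)
  have h1 := hcoord 1 (by decide)
  rw [hK]
  linarith

/-- The heights of the seeds do not change along solutions. -/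
lemma height_eq_of_hasDerivWithinAt {f : (Fin N → E3) → Fin N → E3} (hf : ∀ z i, f z i 2 = 0)
    {T : ℝ} {z : ℝ → Fin N → E3}
    (hz : ∀ t ∈ Icc 0 T, HasDerivWithinAt z (f (z t)) (Icc 0 T) t)
    {t : ℝ} (ht : t ∈ Icc 0 T) (i : Fin N) : z t i 2 = z 0 i 2 := by
  have hd (s : ℝ) (hs : s ∈ Icc 0 T) :
      HasDerivWithinAt (fun s => z s i 2) 0 (Icc 0 T) s := by
    have h1 := (hasDerivWithinAt_pi.1 (hz s hs)) i
    have h2 := (EuclideanSpace.proj (𝕜 := ℝ) (2 : Fin 3)).hasFDerivAt.comp_hasDerivWithinAt s h1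
    simpa [Function.comp_def, hf] using h2
  exact constant_of_has_deriv_right_zero (fun s hs => (hd s hs).continuousWithinAt)
    (fun s hs => (hd s (Ico_subset_Icc_self hs)).mono_of_mem_nhdsWithin
      (Icc_mem_nhdsGE_of_mem hs)) t ht

end Flow

end SemiGeostrophic

end

/-! ### Existence and uniqueness -/

theorem proposition4p4 (N : ℕ) (hN : 2 ≤ N)
    (Ω : Set SemiGeostrophic.E3) (hΩ_open : IsOpen Ω) (hΩ_bdd : Bornology.IsBounded Ω)
    (hΩ_convex : Convex ℝ Ω) (hΩ_vol : MeasureTheory.volume Ω = 1)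
    (m : Fin N → ℝ) (hm_pos : ∀ i, 0 < m i) (hm_sum : ∑ i, m i = 1)
    (zbar : Fin N → SemiGeostrophic.E3) (r : ℝ) (hr : 0 < r)
    (hzbar : ∀ i j, i ≠ j → r ≤ |inner ℝ (zbar i - zbar j) SemiGeostrophic.e3|)
    (T : ℝ) (hT : 0 < T) :
    ∃ z : ℝ → Fin N → SemiGeostrophic.E3,
      SemiGeostrophic.IsC1Solution Ω m zbar T z ∧
        ∀ y : ℝ → Fin N → SemiGeostrophic.E3,
          SemiGeostrophic.IsC1Solution Ω m zbar T y → Set.EqOn y z (Set.Icc 0 T) := by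
  open SemiGeostrophic in
  have : NeZero N := ⟨by omega⟩
  obtain ⟨R₀, hR₀⟩ := hΩ_bdd.exists_norm_le
  have hR : ∀ x ∈ Ω, ‖x‖ ≤ max R₀ 0 := fun x hx => (hR₀ x hx).trans (le_max_left _ _)
  have hsep : HeightSeparated r zbar := by
    intro i j hij
    simpa [e3, EuclideanSpace.inner_single_right] using hzbar i j hij
  obtain ⟨K, hK⟩ := exists_lipschitzWith_vectorField hΩ_open hR (le_max_right _ _) hΩ_vol hr
    hm_pos hm_sum hsep
  obtain ⟨z, hz0, hz⟩ := exists_hasDerivWithinAt_of_lipschitzWith hK zbar hT.le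
  have hheight (t : ℝ) (ht : t ∈ Icc 0 T) (i : Fin N) : z t i 2 = zbar i 2 := by
    rw [height_eq_of_hasDerivWithinAt (f := fun z => vectorField Ω m (withHeights zbar z))
      (fun z i => vectorField_height _ i) hz ht i, hz0]
  have hcont : ContinuousOn z (Icc 0 T) := fun t ht => (hz t ht).continuousWithinAt
  refine ⟨z, ⟨?_, fun t ht i j hij h => ?_, fun t ht => ?_, hz0⟩, fun y hy => ?_⟩
  · rw [contDiffOn_one_iff_derivWithin (uniqueDiffOn_Icc hT)]
    refine ⟨fun t ht => (hz t ht).differentiableWithinAt, ?_⟩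
    refine (hK.continuous.comp_continuousOn hcont).congr fun t ht => ?_
    exact (hz t ht).derivWithin (uniqueDiffOn_Icc hT t ht)
  · have h1 := hsep i j hij
    rw [← hheight t ht, ← hheight t ht, h, sub_self, abs_zero] at h1
    linarith
  · have h1 := hz t ht
    rwa [withHeights_eq_self (hheight t ht)] at h1
  -- Any competitor also conserves heights, so it solves the frozen-height equation, where Lipschitz
  -- uniqueness applies.
  · have hyheight (t : ℝ) (ht : t ∈ Icc 0 T) (i : Fin N) : y t i 2 = zbar i 2 := by
      rw [height_eq_of_hasDerivWithinAt (f := vectorField Ω m) vectorField_height hy.ode ht i,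
        hy.init]
    refine ODE_solution_unique_of_mem_Icc_right
      (v := fun _ z => vectorField Ω m (withHeights zbar z)) (s := fun _ => univ)
      (fun _ _ => hK.lipschitzOnWith) hy.contDiffOn.continuousOn
      (fun t ht => ?_) (fun _ _ => mem_univ _) hcont
      (fun t ht => ?_) (fun _ _ => mem_univ _) (hy.init.trans hz0.symm)
    · have h1 := hy.ode t (Ico_subset_Icc_self ht)
      rw [← withHeights_eq_self (hyheight t (Ico_subset_Icc_self ht))] at h1
      exact h1.mono_of_mem_nhdsWithin (Icc_mem_nhdsGE_of_mem ht)
    · exact (hz t (Ico_subset_Icc_self ht)).mono_of_mem_nhdsWithin (Icc_mem_nhdsGE_of_mem ht)
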